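/- **ISS through a quadratic Lyapunov–Krasovskii functional with point-wise dissipation.** Let $\Delta\ge 0$, $n,m\in\mathbb N$, and let $\mathcal X^n$ be the space of continuous functions $\phi:[-\Delta,0]\to\mathbb R^n$ with norm $\|\phi\|=\max_{\tau\in[-\Delta,0]}|\phi(\tau)|$, where $|\cdot|$ is the Euclidean norm. Consider the time-delay system $$\dot x(t)=f(x_t,u(t)),\qquad t\ge 0,\tag{1}$$ where $x_t(\tau):=x(t+\tau)$ for $\tau\in[-\Delta,0]$, the map $f:\mathcal X^n\times\mathbb R^m\to\mathbb R^n$ satisfies $f(0,0)=0$ and is Lipschitz on bounded sets (for every $r>0$ there is $L>0$ with $|f(\phi_1,v_1)-f(\phi_2,v_2)|\le L(\|\phi_1-\phi_2\|+|v_1-v_2|)$ whenever $\|\phi_i\|\le r$ and $|v_i|\le r$, $i=1,2$), and the inputs $u:[0,\infty)\to\mathbb R^m$ are Lebesgue measurable and locally essentially bounded. A solution of (1) on $[0,T)$, $0<T\le\infty$, with initial state $x_0\in\mathcal X^n$ is a continuous function $x:[-\Delta,T)\to\mathbb R^n$ which agrees with $x_0$ on $[-\Delta,0]$ and satisfies $x(t)=x_0(0)+\int_0^t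 f(x_\tau,u(\tau))\,d\tau$ for all $t\in[0,T)$. A function $\mathbb R_{\ge0}\to\mathbb R_{\ge0}$ is of class $\mathcal N$ if it is continuous, non-decreasing and zero at $0$. A function $\beta:\mathbb R_{\ge0}\times\mathbb R_{\ge0}\to\mathbb R_{\ge0}$ is of class $\mathcal{KL}$ if, for each $t$, $\beta(\cdot,t)$ is continuous, strictly increasing and zero at $0$ and, for each $s$, $\beta(s,\cdot)$ is continuous, non-increasing and tends to $0$ at $+\infty$. The system (1) is *input-to-state stable (ISS)* if there exist $\beta\in\mathcal{KL}$ and $\mu\in\mathcal N$ such that, for every initial state $x_0\in\mathcal X^n$ and every input $u$, the solution exists on $[0,\infty)$ and satisfies $$|x(t)|\le\beta(\|x_0\|,t)+\mu\big(\operatorname{ess\,sup}_{\tau\in[0,t]}|u(\tau)|\big)\qquad\text{for all } t\ge0 .$$ For $V:\mathcal X^n\to\mathbb R_{\ge 0}$ continuous, $\phi\in\mathcal X^n$ and $w\in\mathbb R^n$, *Driver's derivative* is $$D^+V(\phi,w):=\limsup_{h\to0^+}\frac{V(\phi_{h,w})-V(\phi)}{h}\in[-\infty,+\infty],$$ where $\phi_{h,w}(s)=\phi(s+h)$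 for $s\in[-\Delta,0]$ with $s<-h$, and $\phi_{h,w}(s)=\phi(0)+(h+s)w$ for $s\in[-\Delta,0]$ with $s\ge -h$. **Claim.** Assume that there exist symmetric positive definite matrices $P_1,P_2,Q\in\mathbb R^{n\times n}$ and $\gamma\in\mathcal N$ such that the functional $$V(\phi):=\phi(0)^\top P_1\,\phi(0)+\int_{-\Delta}^0\phi(\tau)^\top P_2\,\phi(\tau)\,d\tau,\qquad \phi\in\mathcal X^n,$$ satisfies, for all $\phi\in\mathcal X^n$ and all $v\in\mathbb R^m$, $$D^+V(\phi,f(\phi,v))\le-\phi(0)^\top Q\,\phi(0)+\gamma(|v|).$$ Then the system (1) is ISS. -/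

import Mathlib

open MeasureTheory Filter Set
open scoped NNReal ENNReal Topology Matrix

noncomputable section

namespace DelaySystem

/-- The Euclidean space `ℝⁿ`. -/
abbrev Vec (n : ℕ) : Type := EuclideanSpace ℝ (Fin n)

/-- The state space `𝒳ⁿ` of continuous functions `[-Δ, 0] → ℝⁿ`, with the norm
`‖φ‖ = max |φ(τ)|`. -/
abbrev Hist (Δ : ℝ≥0) (n : ℕ) : Type := C(Icc (-(Δ : ℝ)) 0, Vec n)

theorem neg_delay_nonpos (Δ : ℝ≥0) : -(Δ : ℝ) ≤ 0 := neg_nonpos.mpr Δ.coe_nonneg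

/-- The value of `φ` at a real number `τ ∈ [-Δ, 0]` (extended by constants outside `[-Δ, 0]`). -/
def Hist.val {Δ : ℝ≥0} {n : ℕ} (φ : Hist Δ n) (τ : ℝ) : Vec n :=
  IccExtend (neg_delay_nonpos Δ) φ τ

theorem Hist.val_of_mem {Δ : ℝ≥0} {n : ℕ} (φ : Hist Δ n) {τ : ℝ}
    (hτ : τ ∈ Icc (-(Δ : ℝ)) 0) : φ.val τ = φ ⟨τ, hτ⟩ :=
  IccExtend_of_mem _ _ hτ

theorem Hist.continuous_val {Δ : ℝ≥0} {n : ℕ} (φ : Hist Δ n) : Continuous φ.val :=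
  φ.continuous.Icc_extend'

/-! ### Comparison functions -/

/-- Class `𝒩`: continuous, non-decreasing, zero at zero. -/
structure ClassN (γ : ℝ≥0 → ℝ≥0) : Prop where
  continuous : Continuous γ
  monotone : Monotone γ
  map_zero : γ 0 = 0

/-- Class `𝒦`: continuous, (strictly) increasing, zero at zero. -/
structure ClassK (α : ℝ≥0 → ℝ≥0) : Prop where
  continuous : Continuous α
  strictMono : StrictMono α
  map_zero : α 0 = 0

/-- Class `ℒ`: continuous, non-increasing, tending to zero at infinity. -/
structure ClassL (l : ℝ≥0 → ℝ≥0) : Prop where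
  continuous : Continuous l
  antitone : Antitone l
  tendsto_zero : Tendsto l atTop (𝓝 0)

/-- Class `𝒦ℒ`: class `𝒦` in the first variable, class `ℒ` in the second. -/
structure ClassKL (β : ℝ≥0 → ℝ≥0 → ℝ≥0) : Prop where
  classK : ∀ t, ClassK fun s => β s t
  classL : ∀ s, ClassL fun t => β s t

/-! ### Vector fields, inputs and solutions -/

/-- `f` is Lipschitz on bounded sets. -/
def LipschitzOnBounded {Δ : ℝ≥0} {n m : ℕ} (f : Hist Δ n → Vec m → Vec n) : Prop :=
  ∀ r : ℝ, 0 < r → ∃ L : ℝ, 0 < L ∧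
    ∀ (φ₁ φ₂ : Hist Δ n) (v₁ v₂ : Vec m),
      ‖φ₁‖ ≤ r → ‖φ₂‖ ≤ r → ‖v₁‖ ≤ r → ‖v₂‖ ≤ r →
        ‖f φ₁ v₁ - f φ₂ v₂‖ ≤ L * (‖φ₁ - φ₂‖ + ‖v₁ - v₂‖)

/-- The class `𝒰ᵐ`: Lebesgue measurable and locally essentially bounded signals on `[0, ∞)`.
Only the values `u t` with `0 ≤ t` matter. -/
def IsInput {m : ℕ} (u : ℝ → Vec m) : Prop :=
  ∀ t : ℝ≥0, MemLp u ∞ (volume.restrict (Icc 0 (t : ℝ)))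

/-- The essential supremum norm of the restriction of `u` to `[0, t]`. -/
def inputNorm {m : ℕ} (u : ℝ → Vec m) (t : ℝ≥0) : ℝ≥0 :=
  (eLpNorm u ∞ (volume.restrict (Icc 0 (t : ℝ)))).toNNReal

open Classical in
/-- The history segment `x_t`, `x_t(τ) = x(t + τ)` for `τ ∈ [-Δ, 0]`. It is only used for `x`
continuous on `[t - Δ, t]`; otherwise it is `0` by convention. -/
def segment (Δ : ℝ≥0) {n : ℕ} (x : ℝ → Vec n) (t : ℝ) : Hist Δ n :=
  if h : Continuous (fun τ : Icc (-(Δ : ℝ)) 0 => x (t + τ)) then ⟨_, h⟩ else 0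

/-- `x : [-Δ, T) → ℝⁿ`, `0 < T ≤ ∞`, is a solution on `[0, T)` of `ẋ(t) = f(x_t, u(t))` with initial
state `x₀` and input `u`: it is continuous, extends `x₀`, and satisfies the integral equation
(with an integrable right-hand side). Only the values `x t` with `-Δ ≤ t < T` matter. -/
structure IsSolution {Δ : ℝ≥0} {n m : ℕ} (f : Hist Δ n → Vec m → Vec n)
    (x₀ : Hist Δ n) (u : ℝ → Vec m) (T : EReal) (x : ℝ → Vec n) : Prop where
  pos : 0 < T
  continuousOn : ContinuousOn x {t : ℝ | -(Δ : ℝ) ≤ t ∧ (t : EReal) < T}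
  initial : ∀ τ : Icc (-(Δ : ℝ)) 0, x τ = x₀ τ
  integrable : ∀ t : ℝ, 0 ≤ t → (t : EReal) < T →
    IntervalIntegrable (fun τ => f (segment Δ x τ) (u τ)) volume 0 t
  integral_eq : ∀ t : ℝ, 0 ≤ t → (t : EReal) < T →
    x t = x₀.val 0 + ∫ τ in (0 : ℝ)..t, f (segment Δ x τ) (u τ)

/-- Input-to-state stability of `ẋ(t) = f(x_t, u(t))`: there are `β ∈ 𝒦ℒ` and `μ ∈ 𝒩` such that, for
each initial state and each input, the solution exists on `[0, ∞)` and
`|x(t)| ≤ β(‖x₀‖, t) + μ(‖u_{[0,t]}‖)` for all `t ≥ 0`. The estimate is imposed on every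
solution, on its whole interval of definition, so that no choice of a solution is involved. -/
def InputToStateStable {Δ : ℝ≥0} {n m : ℕ} (f : Hist Δ n → Vec m → Vec n) : Prop :=
  ∃ (β : ℝ≥0 → ℝ≥0 → ℝ≥0) (μ : ℝ≥0 → ℝ≥0), ClassKL β ∧ ClassN μ ∧
    ∀ (x₀ : Hist Δ n) (u : ℝ → Vec m), IsInput u →
      (∃ x : ℝ → Vec n, IsSolution f x₀ u ⊤ x) ∧
      ∀ (T : EReal) (x : ℝ → Vec n), IsSolution f x₀ u T x →
        ∀ t : ℝ≥0, ((t : ℝ) : EReal) < T → ‖x t‖₊ ≤ β ‖x₀‖₊ t + μ (inputNorm u t)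

/-! ### Driver's derivative -/

/-- The function `φ_{h,w}`: `φ_{h,w}(s) = φ(s + h)` for `s ∈ [-Δ, -h)` and
`φ_{h,w}(s) = φ(0) + (h + s) w` for `s ∈ [-h, 0]`. -/
def driverShift {Δ : ℝ≥0} {n : ℕ} (φ : Hist Δ n) (w : Vec n) (h : ℝ) : Hist Δ n where
  toFun s := if (s : ℝ) < -h then φ.val (s + h) else φ.val 0 + (h + s) • w
  continuous_toFun := by
    have key : (fun s : Icc (-(Δ : ℝ)) 0 =>
        if (s : ℝ) < -h then φ.val (s + h) else φ.val 0 + (h + (s : ℝ)) • w) =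
        fun s : Icc (-(Δ : ℝ)) 0 =>
          if -h ≤ (s : ℝ) then φ.val 0 + (h + (s : ℝ)) • w else φ.val (s + h) := by
      funext s
      by_cases hs : (s : ℝ) < -h
      · simp [hs, not_le.mpr hs]
      · simp [hs, not_lt.mp hs]
    rw [key]
    refine Continuous.if_le ?_ ?_ continuous_const continuous_subtype_val ?_
    · fun_prop
    · exact φ.continuous_val.comp (by fun_prop)
    · intro s hs
      simp [← hs]

/-- Driver's derivative
`D⁺V(φ, w) = limsup_{h → 0⁺} (V(φ_{h,w}) - V(φ)) / h`, an extended real number. -/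
def driverDeriv {Δ : ℝ≥0} {n : ℕ} (V : Hist Δ n → ℝ) (φ : Hist Δ n) (w : Vec n) : EReal :=
  limsup (fun h : ℝ => (((V (driverShift φ w h) - V φ) / h : ℝ) : EReal)) (𝓝[>] 0)

/-! ### Quadratic functionals -/

/-- The quadratic form `xᵀ P x`. -/
def quad {n : ℕ} (P : Matrix (Fin n) (Fin n) ℝ) (x : Vec n) : ℝ :=
  x.ofLp ⬝ᵥ (P *ᵥ x.ofLp)

/-- `V(φ) = φ(0)ᵀ P₁ φ(0) + ∫_{-Δ}^0 φ(τ)ᵀ P₂ φ(τ) dτ`. -/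
def quadLKF (Δ : ℝ≥0) {n : ℕ} (P₁ P₂ : Matrix (Fin n) (Fin n) ℝ) (φ : Hist Δ n) : ℝ :=
  quad P₁ (φ.val 0) + ∫ τ in (-(Δ : ℝ))..0, quad P₂ (φ.val τ)

end DelaySystem

end

noncomputable section

namespace DelaySystem

/-! ### Quadratic forms -/

/-! The dissipation controls only `φ(0)`, not all of `V`; an exponential weight repairs this. By
`driverDeriv_quadLKF` the hypothesis is an inequality for `DP₁(φ(0))·f(φ, v)` containing the
boundary terms `P₂[φ(0)] - P₂[φ(-Δ)]` (writing `P[x]` for `xᵀPx`). Along a solution take `W(t) =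
e^{ct} P₁[x(t)] + e^{cΔ} ∫_{t-Δ}^t e^{cτ} P₂[x(τ)] dτ`. In `W'` the delayed terms cancel, and what
remains is at most `e^{ct} (c P₁ + (e^{cΔ} - 1) P₂ - Q)[x(t)] + e^{ct} γ(|u(t)|)`. For small `c` the
form in brackets is nonpositive (`exists_decay_rate`). Integration bounds `|x(t)|²` by an
exponentially decaying multiple of `‖x₀‖²` plus a multiple of `γ(‖u‖)` (`quad_mul_exp_le`), and
square roots give the ISS estimate.

Global existence follows from the same estimate. Truncating the state radially makes the field
globally Lipschitz, with a constant locally bounded in time, and a weighted contraction solves that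
equation (`exists_global_solution_of_lipschitz`). The a priori bound keeps its solution where the
truncation is inactive (`exists_isSolution_of_bound`). -/

theorem quad_eq_sum {n : ℕ} (P : Matrix (Fin n) (Fin n) ℝ) (x : Vec n) :
    quad P x = ∑ i, ∑ j, P i j * (x i * x j) := by
  simp only [quad, dotProduct, Matrix.mulVec, Finset.mul_sum]
  exact Finset.sum_congr rfl fun i _ => Finset.sum_congr rfl fun j _ => by ring

theorem differentiable_quad {n : ℕ} (P : Matrix (Fin n) (Fin n) ℝ) :
    Differentiable ℝ (quad P) := by
  have h : quad P = fun x : Vec n => ∑ i, ∑ j, P i j * (x i * x j) := funext (quad_eq_sum P)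
  rw [h]
  fun_prop

theorem continuous_quad {n : ℕ} (P : Matrix (Fin n) (Fin n) ℝ) : Continuous (quad P) :=
  (differentiable_quad P).continuous

theorem quad_smul {n : ℕ} (P : Matrix (Fin n) (Fin n) ℝ) (r : ℝ) (x : Vec n) :
    quad P (r • x) = r ^ 2 * quad P x := by
  simp only [quad_eq_sum, Finset.mul_sum, PiLp.smul_apply, smul_eq_mul]
  exact Finset.sum_congr rfl fun i _ => Finset.sum_congr rfl fun j _ => by ring

theorem quad_zero {n : ℕ} (P : Matrix (Fin n) (Fin n) ℝ) : quad P 0 = 0 := by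
  simp [quad_eq_sum]

/-- Homogeneity reduces the two-sided bounds on quadratic forms to extrema over the compact unit
sphere. -/
theorem quad_eq_norm_sq_mul {n : ℕ} (P : Matrix (Fin n) (Fin n) ℝ) {x : Vec n} (hx : x ≠ 0) :
    quad P x = ‖x‖ ^ 2 * quad P (‖x‖⁻¹ • x) := by
  rw [← quad_smul, smul_smul, mul_inv_cancel₀ (norm_ne_zero_iff.mpr hx), one_smul]

theorem inv_norm_smul_mem_sphere {n : ℕ} {x : Vec n} (hx : x ≠ 0) :
    ‖x‖⁻¹ • x ∈ Metric.sphere (0 : Vec n) 1 := by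
  rw [mem_sphere_zero_iff_norm, norm_smul, norm_inv, norm_norm,
    inv_mul_cancel₀ (norm_ne_zero_iff.mpr hx)]

theorem exists_quad_le {n : ℕ} (P : Matrix (Fin n) (Fin n) ℝ) :
    ∃ C : ℝ, 0 < C ∧ ∀ x : Vec n, quad P x ≤ C * ‖x‖ ^ 2 := by
  obtain ⟨C, hC⟩ := (isCompact_sphere (0 : Vec n) 1).exists_bound_of_continuousOn
    (continuous_quad P).continuousOn
  refine ⟨max C 1, by positivity, fun x => ?_⟩
  rcases eq_or_ne x 0 with rfl | hx
  · simp [quad_zero]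
  · rw [quad_eq_norm_sq_mul P hx, mul_comm]
    gcongr
    exact ((le_abs_self _).trans (hC _ (inv_norm_smul_mem_sphere hx))).trans (le_max_left _ _)

theorem quad_pos {n : ℕ} {P : Matrix (Fin n) (Fin n) ℝ} (hP : P.PosDef) {x : Vec n}
    (hx : x ≠ 0) : 0 < quad P x := by
  have h : x.ofLp ≠ 0 := fun h => hx (by ext i; exact congrFun h i)
  simpa [quad] using hP.dotProduct_mulVec_pos h

theorem quad_nonneg {n : ℕ} {P : Matrix (Fin n) (Fin n) ℝ} (hP : P.PosDef) (x : Vec n) :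
    0 ≤ quad P x := by
  rcases eq_or_ne x 0 with rfl | hx
  · simp [quad_zero]
  · exact (quad_pos hP hx).le

theorem exists_le_quad {n : ℕ} {P : Matrix (Fin n) (Fin n) ℝ} (hP : P.PosDef) :
    ∃ a : ℝ, 0 < a ∧ ∀ x : Vec n, a * ‖x‖ ^ 2 ≤ quad P x := by
  obtain ⟨a, ha, h⟩ : ∃ a : ℝ, 0 < a ∧ ∀ x ∈ Metric.sphere (0 : Vec n) 1, a ≤ quad P x := by
    -- The sphere is empty exactly when `n = 0`.
    rcases (Metric.sphere (0 : Vec n) 1).eq_empty_or_nonempty with h | h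
    · exact ⟨1, one_pos, by simp [h]⟩
    · obtain ⟨x, hx, hm⟩ := (isCompact_sphere (0 : Vec n) 1).exists_isMinOn h
        (continuous_quad P).continuousOn
      exact ⟨quad P x, quad_pos hP (ne_zero_of_mem_unit_sphere ⟨x, hx⟩), fun y hy => hm hy⟩
  refine ⟨a, ha, fun x => ?_⟩
  rcases eq_or_ne x 0 with rfl | hx
  · simp [quad_zero]
  · rw [quad_eq_norm_sq_mul P hx, mul_comm]
    gcongr
    exact h _ (inv_norm_smul_mem_sphere hx)

/-- A rate `c > 0` for which `c P₁ + (exp (c Δ) - 1) P₂ ≤ Q` in the sense of quadratic forms. -/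
theorem exists_decay_rate {n : ℕ} (Δ : ℝ) (P₁ P₂ : Matrix (Fin n) (Fin n) ℝ)
    {Q : Matrix (Fin n) (Fin n) ℝ} (hΔ : 0 ≤ Δ) (hQ : Q.PosDef) :
    ∃ c : ℝ, 0 < c ∧ ∀ x : Vec n,
      c * quad P₁ x + (Real.exp (c * Δ) - 1) * quad P₂ x ≤ quad Q x := by
  obtain ⟨C₁, -, h₁⟩ := exists_quad_le P₁
  obtain ⟨C₂, -, h₂⟩ := exists_quad_le P₂
  obtain ⟨q, hq, hqQ⟩ := exists_le_quad hQ
  -- The coefficient vanishes at `c = 0`, so it stays below `q` for small `c > 0`.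
  have hcont : Continuous fun c : ℝ => c * C₁ + (Real.exp (c * Δ) - 1) * C₂ := by fun_prop
  have hlim := hcont.tendsto 0
  simp only [zero_mul, Real.exp_zero, sub_self, add_zero] at hlim
  have hev : ∀ᶠ c : ℝ in 𝓝[>] 0, c * C₁ + (Real.exp (c * Δ) - 1) * C₂ < q :=
    (hlim.eventually_lt_const hq).filter_mono nhdsWithin_le_nhds
  obtain ⟨c, hc, hc0⟩ := (hev.and self_mem_nhdsWithin).exists
  have hc0 : 0 < c := hc0
  refine ⟨c, hc0, fun x => ?_⟩
  have he : 0 ≤ Real.exp (c * Δ) - 1 := by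
    have := Real.one_le_exp (x := c * Δ) (by positivity)
    linarith
  calc c * quad P₁ x + (Real.exp (c * Δ) - 1) * quad P₂ x
      ≤ c * (C₁ * ‖x‖ ^ 2) + (Real.exp (c * Δ) - 1) * (C₂ * ‖x‖ ^ 2) := by
        gcongr
        · exact h₁ x
        · exact h₂ x
    _ = (c * C₁ + (Real.exp (c * Δ) - 1) * C₂) * ‖x‖ ^ 2 := by ring
    _ ≤ q * ‖x‖ ^ 2 := by gcongr
    _ ≤ quad Q x := hqQ x

/-! ### Driver's derivative of a quadratic functional -/

theorem hasDerivAt_integral_sub_const {g : ℝ → ℝ} (hg : Continuous g) (d t : ℝ) :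
    HasDerivAt (fun s => ∫ τ in (s - d)..s, g τ) (g t - g (t - d)) t := by
  have h : (fun s => ∫ τ in (s - d)..s, g τ) =
      fun s => (∫ τ in (0 : ℝ)..s, g τ) - ∫ τ in (0 : ℝ)..(s - d), g τ := by
    funext s
    rw [intervalIntegral.integral_interval_sub_left] <;> exact hg.intervalIntegrable _ _
  rw [h]
  refine (hg.integral_hasStrictDerivAt 0 t).hasDerivAt.sub ?_
  exact (hg.integral_hasStrictDerivAt 0 (t - d)).hasDerivAt.comp_sub_const t d

theorem val_zero_of_nonneg {Δ : ℝ≥0} {n : ℕ} (φ : Hist Δ n) {t : ℝ} (ht : 0 ≤ t) :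
    φ.val t = φ.val 0 := by
  simp only [Hist.val]
  rw [IccExtend_of_right_le _ _ ht, IccExtend_of_right_le _ _ le_rfl]

/-- Since `φ.val` is constant to the right of `0`, both branches merge into this extension plus a
ramp, evaluated at `τ + h`. -/
theorem driverShift_val {Δ : ℝ≥0} {n : ℕ} (φ : Hist Δ n) (w : Vec n) {h τ : ℝ}
    (hτ : τ ∈ Icc (-(Δ : ℝ)) 0) :
    (driverShift φ w h).val τ = φ.val (τ + h) + max (τ + h) 0 • w := by
  rw [Hist.val_of_mem _ hτ]
  change (if τ < -h then φ.val (τ + h) else φ.val 0 + (h + τ) • w) = _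
  split_ifs with hlt
  · rw [max_eq_right (by linarith)]
    simp
  · rw [max_eq_left (by linarith), val_zero_of_nonneg φ (by linarith : 0 ≤ τ + h), add_comm h]

/-- All shifts are windows of one curve `y` independent of `h`, so the integral runs over a sliding
window of a fixed continuous integrand. The difference quotient then has a genuine limit, and the
limsup equals it. -/
theorem driverDeriv_quadLKF {Δ : ℝ≥0} {n : ℕ} (P₁ P₂ : Matrix (Fin n) (Fin n) ℝ)
    (φ : Hist Δ n) (w : Vec n) :
    driverDeriv (quadLKF Δ P₁ P₂) φ w =
      ((fderiv ℝ (quad P₁) (φ.val 0) w + quad P₂ (φ.val 0) - quad P₂ (φ.val (-Δ)) : ℝ) :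
        EReal) := by
  set y : ℝ → Vec n := fun t => φ.val t + max t 0 • w with hy
  have hyc : Continuous y := φ.continuous_val.add (by fun_prop)
  have hlin : HasDerivAt (fun h : ℝ => φ.val 0 + h • w) w 0 := by
    simpa using ((hasDerivAt_id (0 : ℝ)).smul_const w).const_add (φ.val 0)
  have h₁ : HasDerivAt (fun h : ℝ => quad P₁ (φ.val 0 + h • w))
      (fderiv ℝ (quad P₁) (φ.val 0) w) 0 := by
    have := ((differentiable_quad P₁) (φ.val 0 + (0 : ℝ) • w)).hasFDerivAt.comp_hasDerivAt 0 hlin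
    simpa [Function.comp_def] using this
  have h₂ := hasDerivAt_integral_sub_const ((continuous_quad P₂).comp hyc) Δ 0
  have h₃ := (h₁.add h₂).tendsto_slope_zero_right
  have hV : ∀ h : ℝ, 0 ≤ h → quadLKF Δ P₁ P₂ (driverShift φ w h) =
      quad P₁ (φ.val 0 + h • w) + ∫ τ in (h - Δ)..h, quad P₂ (y τ) := by
    intro h hh
    simp only [quadLKF]
    congr 1
    · rw [driverShift_val φ w ⟨neg_delay_nonpos Δ, le_rfl⟩, zero_add, max_eq_left hh,
        val_zero_of_nonneg φ hh]
    · have : ∫ τ in (h - Δ)..h, quad P₂ (y τ) = ∫ τ in (-(Δ : ℝ))..0, quad P₂ (y (τ + h)) := by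
        rw [intervalIntegral.integral_comp_add_right (fun τ => quad P₂ (y τ))]
        congr 1 <;> ring
      rw [this]
      refine intervalIntegral.integral_congr fun τ hτ => ?_
      rw [uIcc_of_le (neg_delay_nonpos Δ)] at hτ
      simp only [driverShift_val φ w hτ, hy]
  have hV0 : quadLKF Δ P₁ P₂ φ =
      quad P₁ (φ.val 0 + (0 : ℝ) • w) + ∫ τ in ((0 : ℝ) - Δ)..0, quad P₂ (y τ) := by
    simp only [quadLKF, zero_smul, add_zero, zero_sub]
    congr 1
    refine intervalIntegral.integral_congr fun τ hτ => ?_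
    rw [uIcc_of_le (neg_delay_nonpos Δ)] at hτ
    simp [hy, max_eq_right hτ.2]
  have hlim : Tendsto (fun h : ℝ =>
      (quadLKF Δ P₁ P₂ (driverShift φ w h) - quadLKF Δ P₁ P₂ φ) / h) (𝓝[>] 0)
      (𝓝 (fderiv ℝ (quad P₁) (φ.val 0) w + quad P₂ (φ.val 0) - quad P₂ (φ.val (-Δ)))) := by
    have e : fderiv ℝ (quad P₁) (φ.val 0) w + quad P₂ (φ.val 0) - quad P₂ (φ.val (-Δ)) =
        fderiv ℝ (quad P₁) (φ.val 0) w +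
          ((quad P₂ ∘ y) 0 - (quad P₂ ∘ y) (0 - (Δ : ℝ))) := by
      simp [hy, add_sub_assoc]
    rw [e]
    refine h₃.congr' ?_
    filter_upwards [self_mem_nhdsWithin] with h hh
    rw [hV h (le_of_lt hh), hV0]
    simp [div_eq_inv_mul]
  exact ((continuous_coe_real_ereal.tendsto _).comp hlim).limsup_eq

/-! ### Absolutely continuous functions -/

/-- With a merely measurable input, solutions are differentiable only almost everywhere; absolute
continuity is what turns an a.e. sign of the derivative into monotonicity. -/
theorem le_of_absolutelyContinuousOnInterval_of_ae_hasDerivAt_nonpos {g : ℝ → ℝ} {a b : ℝ}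
    (hab : a ≤ b) (hg : AbsolutelyContinuousOnInterval g a b)
    (hd : ∀ᵐ s, s ∈ Icc a b → ∃ d ≤ 0, HasDerivAt g d s) : g b ≤ g a := by
  rw [← sub_nonpos, ← hg.integral_deriv_eq_sub, intervalIntegral.integral_of_le hab]
  refine setIntegral_nonpos_ae measurableSet_Ioc ?_
  filter_upwards [hd] with s hs hmem
  obtain ⟨d, hd0, hd⟩ := hs (Ioc_subset_Icc_self hmem)
  rwa [hd.deriv]

theorem absolutelyContinuousOnInterval_of_eqOn {g₁ g₂ : ℝ → ℝ} {a b : ℝ}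
    (hg : AbsolutelyContinuousOnInterval g₁ a b) (h : EqOn g₁ g₂ (uIcc a b)) :
    AbsolutelyContinuousOnInterval g₂ a b := by
  refine Tendsto.congr' ?_ hg
  -- The defining filter contains the families of subintervals of `uIcc a b`, on which both
  -- functions give equal sums.
  filter_upwards [mem_inf_of_right (mem_principal_self _)] with E hE
  refine Finset.sum_congr rfl fun i hi => ?_
  rw [h (hE.1 i hi).1, h (hE.1 i hi).2]

theorem absolutelyContinuousOnInterval_const (r a b : ℝ) :
    AbsolutelyContinuousOnInterval (fun _ => r) a b :=
  contDiffOn_const.absolutelyContinuousOnInterval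

theorem absolutelyContinuousOnInterval_sum {ι : Type*} (s : Finset ι) {g : ι → ℝ → ℝ} {a b : ℝ}
    (hg : ∀ i ∈ s, AbsolutelyContinuousOnInterval (g i) a b) :
    AbsolutelyContinuousOnInterval (fun t => ∑ i ∈ s, g i t) a b := by
  classical
  induction s using Finset.induction_on with
  | empty => simpa using absolutelyContinuousOnInterval_const 0 a b
  | insert i s hi ih =>
    simp only [Finset.sum_insert hi]
    exact (hg i (Finset.mem_insert_self i s)).add
      (ih fun j hj => hg j (Finset.mem_insert_of_mem hj))

theorem absolutelyContinuousOnInterval_quad_integral {n : ℕ} (P : Matrix (Fin n) (Fin n) ℝ)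
    (x₀ : Vec n) {g : ℝ → Vec n} {a b : ℝ} (hg : IntervalIntegrable g volume a b) :
    AbsolutelyContinuousOnInterval (fun t => quad P (x₀ + ∫ τ in a..t, g τ)) a b := by
  have hi : ∀ i, AbsolutelyContinuousOnInterval
      (fun t => (x₀ + ∫ τ in a..t, g τ : Vec n) i) a b := by
    intro i
    have hgi : IntervalIntegrable (fun t => g t i) volume a b :=
      ⟨(EuclideanSpace.proj (𝕜 := ℝ) i).integrable_comp hg.1,
        (EuclideanSpace.proj (𝕜 := ℝ) i).integrable_comp hg.2⟩
    have h := (absolutelyContinuousOnInterval_const (x₀ i) a b).add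
      (hgi.absolutelyContinuousOnInterval_intervalIntegral (c := a) left_mem_uIcc)
    refine absolutelyContinuousOnInterval_of_eqOn h fun t ht => ?_
    have hgt : IntervalIntegrable g volume a t :=
      hg.mono_set (uIcc_subset_uIcc left_mem_uIcc ht)
    have : ∫ τ in a..t, g τ i = (∫ τ in a..t, g τ : Vec n) i :=
      (EuclideanSpace.proj (𝕜 := ℝ) i).intervalIntegral_comp_comm hgt
    simp [this]
  simp only [quad_eq_sum]
  exact absolutelyContinuousOnInterval_sum _ fun i _ => absolutelyContinuousOnInterval_sum _
    fun j _ => ((hi i).mul (hi j)).const_mul _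

/-! ### History segments -/

theorem segment_apply {Δ : ℝ≥0} {n : ℕ} {x : ℝ → Vec n} (hx : Continuous x) (t : ℝ)
    (τ : Icc (-(Δ : ℝ)) 0) : segment Δ x t τ = x (t + τ) := by
  rw [segment, dif_pos (by fun_prop)]
  rfl

theorem segment_val {Δ : ℝ≥0} {n : ℕ} {x : ℝ → Vec n} (hx : Continuous x) (t : ℝ) {τ : ℝ}
    (hτ : τ ∈ Icc (-(Δ : ℝ)) 0) : (segment Δ x t).val τ = x (t + τ) := by
  rw [Hist.val_of_mem _ hτ, segment_apply hx]

/-! ### The exponentially weighted functional along solutions -/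

/-- The core estimate: the weighted functional, corrected for the input, is non-increasing on `[0,
t]`. -/
theorem quad_mul_exp_le {Δ : ℝ≥0} {n m : ℕ} {f : Hist Δ n → Vec m → Vec n}
    {P₁ P₂ Q : Matrix (Fin n) (Fin n) ℝ} (hP₂ : P₂.PosDef)
    {γ : ℝ≥0 → ℝ≥0} (hγ : Monotone γ)
    (hV : ∀ (φ : Hist Δ n) (v : Vec m),
      fderiv ℝ (quad P₁) (φ.val 0) (f φ v) + quad P₂ (φ.val 0) - quad P₂ (φ.val (-Δ)) ≤
        -quad Q (φ.val 0) + γ ‖v‖₊)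
    {c : ℝ} (hc : 0 < c)
    (hrate : ∀ x : Vec n, c * quad P₁ x + (Real.exp (c * Δ) - 1) * quad P₂ x ≤ quad Q x)
    {C₁ C₂ : ℝ} (hC₁ : ∀ x : Vec n, quad P₁ x ≤ C₁ * ‖x‖ ^ 2)
    (hC₁0 : 0 < C₁) (hC₂0 : 0 < C₂) (hC₂ : ∀ x : Vec n, quad P₂ x ≤ C₂ * ‖x‖ ^ 2)
    {x : ℝ → Vec n} (hx : Continuous x) {u : ℝ → Vec m} {t R : ℝ} {M : ℝ≥0} (ht : 0 ≤ t)
    (hint : IntervalIntegrable (fun τ => f (segment Δ x τ) (u τ)) volume 0 t)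
    (heq : ∀ s ∈ Icc 0 t, x s = x 0 + ∫ τ in (0 : ℝ)..s, f (segment Δ x τ) (u τ))
    (hinit : ∀ s ∈ Icc (-(Δ : ℝ)) 0, ‖x s‖ ≤ R)
    (hu : ∀ᵐ s, s ∈ Icc 0 t → ‖u s‖₊ ≤ M) :
    quad P₁ (x t) * Real.exp (c * t) ≤
      (C₁ + Real.exp (c * Δ) * Δ * C₂) * R ^ 2 + γ M / c * Real.exp (c * t) := by
  set g : ℝ → Vec n := fun τ => f (segment Δ x τ) (u τ) with hg
  -- `x` obeys the integral equation only on `[0, t]`; two-sided derivatives are taken of the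
  -- primitive `y`, which agrees with `x` there.
  set y : ℝ → Vec n := fun s => x 0 + ∫ τ in (0 : ℝ)..s, g τ with hy
  set k : ℝ → ℝ := fun τ => Real.exp (c * τ) * quad P₂ (x τ) with hk
  have hkc : Continuous k := by
    have := continuous_quad P₂
    fun_prop
  have hk0 : ∀ τ, 0 ≤ k τ := fun τ => mul_nonneg (Real.exp_pos _).le (quad_nonneg hP₂ _)
  set I : ℝ → ℝ := fun s => ∫ τ in (s - Δ)..s, k τ with hI
  have hId : ∀ s, HasDerivAt I (k s - k (s - Δ)) s := hasDerivAt_integral_sub_const hkc Δ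
  have hIC : ContDiff ℝ 1 I := by
    refine contDiff_one_iff_deriv.mpr ⟨fun s => (hId s).differentiableAt, ?_⟩
    rw [funext fun s => (hId s).deriv]
    fun_prop
  have hed : ∀ s, HasDerivAt (fun s => Real.exp (c * s)) (Real.exp (c * s) * c) s := fun s => by
    simpa using ((hasDerivAt_id s).const_mul c).exp
  have hexpC : ContDiff ℝ 1 fun s : ℝ => Real.exp (c * s) := by fun_prop
  -- The last term has derivative `γ M e^{cs}` before its sign, which absorbs the input.
  set h : ℝ → ℝ := fun s => Real.exp (c * s) * quad P₁ (y s) + Real.exp (c * Δ) * I s -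
    γ M / c * Real.exp (c * s) with hh
  have hAC : AbsolutelyContinuousOnInterval h 0 t :=
    ((hexpC.contDiffOn.absolutelyContinuousOnInterval.mul
      (absolutelyContinuousOnInterval_quad_integral P₁ (x 0) hint)).add
      (hIC.contDiffOn.absolutelyContinuousOnInterval.const_mul _)).sub
      (hexpC.contDiffOn.absolutelyContinuousOnInterval.const_mul _)
  have hle : h t ≤ h 0 := by
    refine le_of_absolutelyContinuousOnInterval_of_ae_hasDerivAt_nonpos ht hAC ?_
    filter_upwards [hint.ae_hasDerivAt_integral, hu] with s hs hus hmem
    have hs := (hs (by rwa [uIcc_of_le ht]) 0 left_mem_uIcc).const_add (x 0)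
    have hys : y s = x s := (heq s hmem).symm
    have hq : HasDerivAt (fun s => quad P₁ (y s)) (fderiv ℝ (quad P₁) (x s) (g s)) s := by
      rw [← hys]
      exact ((differentiable_quad P₁) (y s)).hasFDerivAt.comp_hasDerivAt s hs
    refine ⟨_, ?_, (((hed s).mul hq).add ((hId s).const_mul _)).sub ((hed s).const_mul _)⟩
    have hdis := hV (segment Δ x s) (u s)
    rw [segment_val hx s ⟨neg_delay_nonpos Δ, le_rfl⟩,
      segment_val hx s ⟨le_rfl, neg_delay_nonpos Δ⟩, add_zero, ← sub_eq_add_neg] at hdis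
    have hγM : (γ ‖u s‖₊ : ℝ) ≤ γ M := NNReal.coe_le_coe.mpr (hγ (hus hmem))
    have hr := hrate (x s)
    -- The factor `e^{cΔ}` in front of the integral makes the delayed term of its derivative exactly
    -- `-e^{cs} P₂[x(s - Δ)]`, matching the one in `hdis`.
    have hexp : Real.exp (c * Δ) * Real.exp (c * (s - Δ)) = Real.exp (c * s) := by
      rw [← Real.exp_add]
      ring_nf
    have hkey : fderiv ℝ (quad P₁) (x s) (g s) + c * quad P₁ (x s) +
        Real.exp (c * Δ) * quad P₂ (x s) - quad P₂ (x (s - Δ)) - γ M ≤ 0 := by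
      linarith
    have := mul_nonpos_of_nonneg_of_nonpos (Real.exp_pos (c * s)).le hkey
    refine le_of_eq_of_le ?_ this
    simp only [hys, hk]
    rw [mul_sub, ← mul_assoc _ (Real.exp (c * (s - Δ))), hexp]
    field_simp
    ring
  have hI0 : I 0 ≤ Δ * (C₂ * R ^ 2) := by
    have hb : ∀ τ ∈ Icc (-(Δ : ℝ)) 0, k τ ≤ C₂ * R ^ 2 := by
      intro τ hτ
      have he : Real.exp (c * τ) ≤ 1 :=
        Real.exp_le_one_iff.mpr (mul_nonpos_of_nonneg_of_nonpos hc.le hτ.2)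
      calc k τ ≤ 1 * (C₂ * ‖x τ‖ ^ 2) := mul_le_mul he (hC₂ _) (quad_nonneg hP₂ _) zero_le_one
        _ ≤ C₂ * R ^ 2 := by
          rw [one_mul]
          gcongr
          exact hinit τ hτ
    have := intervalIntegral.integral_mono_on (neg_delay_nonpos Δ)
      (hkc.intervalIntegrable (μ := volume) _ _) intervalIntegrable_const hb
    simpa [hI, mul_left_comm] using this
  -- At the final time the integral is discarded; only its sign is needed.
  have hIt : 0 ≤ I t :=
    intervalIntegral.integral_nonneg (by linarith [Δ.coe_nonneg]) fun τ _ => hk0 τ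
  have hy0 : y 0 = x 0 := by simp [hy]
  have hyt : y t = x t := (heq t ⟨ht, le_rfl⟩).symm
  have hq0 : quad P₁ (x 0) ≤ C₁ * R ^ 2 := by
    refine (hC₁ _).trans ?_
    gcongr
    exact hinit 0 ⟨neg_delay_nonpos Δ, le_rfl⟩
  simp only [hh, hy0, hyt, mul_zero, Real.exp_zero, one_mul, mul_one] at hle
  have hγ0 : 0 ≤ γ M / c := by positivity
  have h1 := mul_le_mul_of_nonneg_left hI0 (Real.exp_pos (c * Δ)).le
  have h2 := mul_nonneg (Real.exp_pos (c * Δ)).le hIt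
  linarith

/-! ### Global solutions under a locally bounded Lipschitz constant -/

theorem continuous_segment {Δ : ℝ≥0} {n : ℕ} {x : ℝ → Vec n} (hx : Continuous x) :
    Continuous (segment Δ x) := by
  let c : C(ℝ × Icc (-(Δ : ℝ)) 0, Vec n) := ⟨fun p => x (p.1 + p.2), by fun_prop⟩
  have h : segment Δ x = c.curry := by
    funext t
    ext1 τ
    rw [segment_apply hx]
    rfl
  rw [h]
  exact c.curry.continuous

theorem norm_val_le {Δ : ℝ≥0} {n : ℕ} (φ : Hist Δ n) (t : ℝ) : ‖φ.val t‖ ≤ ‖φ‖ :=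
  φ.norm_coe_le_norm _

theorem norm_segment_le {Δ : ℝ≥0} {n : ℕ} {x : ℝ → Vec n} (hx : Continuous x) {t C : ℝ}
    (hC : 0 ≤ C) (h : ∀ s ≤ t, -(Δ : ℝ) ≤ s - t → ‖x s‖ ≤ C) : ‖segment Δ x t‖ ≤ C := by
  refine (ContinuousMap.norm_le _ hC).mpr fun τ => ?_
  rw [segment_apply hx]
  exact h _ (by linarith [τ.2.2]) (by linarith [τ.2.1])

theorem norm_segment_sub_le {Δ : ℝ≥0} {n : ℕ} {x y : ℝ → Vec n} (hx : Continuous x)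
    (hy : Continuous y) {t C : ℝ} (hC : 0 ≤ C) (h : ∀ s ≤ t, ‖x s - y s‖ ≤ C) :
    ‖segment Δ x t - segment Δ y t‖ ≤ C := by
  refine (ContinuousMap.norm_le _ hC).mpr fun τ => ?_
  rw [ContinuousMap.sub_apply, segment_apply hx, segment_apply hy]
  exact h _ (by linarith [τ.2.2])

/-- Picard iteration in a weighted sup norm, global in one step: `w' = 2 l w` gives `∫₀ᵗ l w ≤ w(t)
/ 2`, hence contraction constant `1/2`. -/
theorem exists_global_solution_of_lipschitz {Δ : ℝ≥0} {n : ℕ} (x₀ : Hist Δ n)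
    {F : ℝ → Hist Δ n → Vec n} {l : ℝ → ℝ} (hl : Continuous l) (hl0 : ∀ s, 0 ≤ l s)
    (hLip : ∀ᵐ s, ∀ φ ψ, ‖F s φ - F s ψ‖ ≤ l s * ‖φ - ψ‖) (hF0 : ∀ᵐ s, ‖F s 0‖ ≤ l s)
    (hmeas : ∀ x : ℝ → Vec n, Continuous x →
      AEStronglyMeasurable (fun s => F s (segment Δ x s)) volume) :
    ∃ x : ℝ → Vec n, Continuous x ∧ (∀ t ≤ 0, x t = x₀.val t) ∧
      (∀ a b : ℝ, IntervalIntegrable (fun s => F s (segment Δ x s)) volume a b) ∧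
      ∀ t, 0 ≤ t → x t = x₀.val 0 + ∫ s in (0 : ℝ)..t, F s (segment Δ x s) := by
  set w : ℝ → ℝ := fun t => Real.exp (2 * ∫ s in (0 : ℝ)..t, l s) with hw
  have hwd : ∀ t, HasDerivAt w (2 * (l t * w t)) t := fun t => by
    have := ((hl.integral_hasStrictDerivAt 0 t).hasDerivAt.const_mul 2).exp
    convert! this using 1
    ring
  have hwc : Continuous w := continuous_iff_continuousAt.mpr fun t => (hwd t).continuousAt
  have hwpos : ∀ t, 0 < w t := fun t => Real.exp_pos _
  have hwm : Monotone w := monotone_of_hasDerivAt_nonneg hwd fun t =>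
    mul_nonneg zero_le_two (mul_nonneg (hl0 t) (hwpos t).le)
  have hw0 : w 0 = 1 := by simp [hw]
  have hwi : ∀ t, 0 ≤ t → ∫ s in (0 : ℝ)..t, l s * w s ≤ w t / 2 := fun t _ => by
    have := intervalIntegral.integral_eq_sub_of_hasDerivAt (fun s _ => hwd s)
      (((hl.mul hwc).const_mul 2).intervalIntegrable (μ := volume) 0 t)
    rw [intervalIntegral.integral_const_mul, hw0] at this
    linarith
  -- The unknown is the bounded quotient `z = (x - x₀) / w`. The `max t 0` in the operator below
  -- forces the fixed point to vanish for `t ≤ 0`, which encodes the initial state.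
  let X : BoundedContinuousFunction ℝ (Vec n) → ℝ → Vec n := fun z t => x₀.val t + w t • z t
  have hX : ∀ z, Continuous (X z) := fun z => x₀.continuous_val.add (hwc.smul z.continuous)
  let G : BoundedContinuousFunction ℝ (Vec n) → ℝ → Vec n := fun z s => F s (segment Δ (X z) s)
  have hseg : ∀ z s, ‖segment Δ (X z) s‖ ≤ ‖x₀‖ + w s * ‖z‖ := fun z s => by
    have := hwpos s
    refine norm_segment_le (hX z) (by positivity) fun r hr _ => ?_
    refine (norm_add_le _ _).trans (add_le_add (norm_val_le _ _) ?_)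
    rw [norm_smul, Real.norm_of_nonneg (hwpos r).le]
    exact mul_le_mul (hwm hr) (z.norm_coe_le_norm r) (norm_nonneg _) this.le
  have hGb : ∀ z, ∀ᵐ s, ‖G z s‖ ≤ l s * (1 + (‖x₀‖ + w s * ‖z‖)) := fun z => by
    filter_upwards [hLip, hF0] with s h1 h2
    have h3 := h1 (segment Δ (X z) s) 0
    rw [sub_zero] at h3
    calc ‖G z s‖ ≤ ‖F s 0‖ + ‖F s (segment Δ (X z) s) - F s 0‖ := norm_le_insert' _ _
      _ ≤ l s + l s * (‖x₀‖ + w s * ‖z‖) :=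
        add_le_add h2 (h3.trans (mul_le_mul_of_nonneg_left (hseg z s) (hl0 s)))
      _ = _ := by ring
  have hGi : ∀ z a b, IntervalIntegrable (G z) volume a b := fun z a b => by
    refine IntervalIntegrable.mono_fun' (g := fun s => l s * (1 + (‖x₀‖ + w s * ‖z‖)))
      (Continuous.intervalIntegrable (by fun_prop) a b) (hmeas _ (hX z)).restrict ?_
    exact ae_restrict_of_ae (hGb z)
  have hGint : ∀ z, Continuous fun t => ∫ s in (0 : ℝ)..(max t 0), G z s := fun z =>
    (intervalIntegral.continuous_primitive (hGi z) 0).comp (continuous_id.max continuous_const)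
  have hbound : ∀ {g : ℝ → Vec n} {C : ℝ}, (∀ᵐ s, 0 ≤ s → ‖g s‖ ≤ C * (l s * w s)) →
      0 ≤ C → ∀ t, ‖(w t)⁻¹ • ∫ s in (0 : ℝ)..(max t 0), g s‖ ≤ C / 2 := by
    intro g C hg hC t
    rcases le_total t 0 with ht | ht
    · rw [max_eq_right ht]
      simpa using div_nonneg hC zero_le_two
    · rw [max_eq_left ht, norm_smul, norm_inv, Real.norm_of_nonneg (hwpos t).le,
        inv_mul_le_iff₀ (hwpos t)]
      calc ‖∫ s in (0 : ℝ)..t, g s‖ ≤ ∫ s in (0 : ℝ)..t, C * (l s * w s) := by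
            refine intervalIntegral.norm_integral_le_of_norm_le ht ?_
              (Continuous.intervalIntegrable (by fun_prop) 0 t)
            filter_upwards [hg] with s hs hmem using hs hmem.1.le
        _ ≤ C * (w t / 2) := by
            rw [intervalIntegral.integral_const_mul]
            exact mul_le_mul_of_nonneg_left (hwi t ht) hC
        _ = w t * (C / 2) := by ring
  have hTb : ∀ z t, ‖(w t)⁻¹ • ∫ s in (0 : ℝ)..(max t 0), G z s‖ ≤ (1 + ‖x₀‖ + ‖z‖) / 2 := by
    intro z
    refine hbound ?_ (by positivity)
    filter_upwards [hGb z] with s hs hs0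
    have h1 : 1 ≤ w s := hw0 ▸ hwm hs0
    calc ‖G z s‖ ≤ l s * (1 + (‖x₀‖ + w s * ‖z‖)) := hs
      _ ≤ l s * ((1 + ‖x₀‖) * w s + w s * ‖z‖) := by
        refine mul_le_mul_of_nonneg_left ?_ (hl0 s)
        rw [← add_assoc]
        gcongr
        exact le_mul_of_one_le_right (by positivity) h1
      _ = _ := by ring
  let T : BoundedContinuousFunction ℝ (Vec n) → BoundedContinuousFunction ℝ (Vec n) := fun z =>
    BoundedContinuousFunction.ofNormedAddCommGroup
      (fun t => (w t)⁻¹ • ∫ s in (0 : ℝ)..(max t 0), G z s)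
      ((hwc.inv₀ fun t => (hwpos t).ne').smul (hGint z)) _ (hTb z)
  have hT : ContractingWith (1 / 2) T := by
    refine ⟨by norm_num, LipschitzWith.of_dist_le_mul fun z z' => ?_⟩
    rw [BoundedContinuousFunction.dist_le (by positivity)]
    intro t
    rw [dist_eq_norm, dist_eq_norm]
    change ‖(w t)⁻¹ • (∫ s in (0 : ℝ)..(max t 0), G z s) -
      (w t)⁻¹ • (∫ s in (0 : ℝ)..(max t 0), G z' s)‖ ≤ _
    rw [← smul_sub, ← intervalIntegral.integral_sub (hGi z _ _) (hGi z' _ _)]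
    refine (hbound (C := ‖z - z'‖) ?_ (norm_nonneg _) t).trans (le_of_eq ?_)
    · filter_upwards [hLip] with s hs _
      have h1 : ‖segment Δ (X z) s - segment Δ (X z') s‖ ≤ w s * ‖z - z'‖ := by
        have := hwpos s
        refine norm_segment_sub_le (hX z) (hX z') (by positivity) fun r hr => ?_
        have h2 : X z r - X z' r = w r • (z - z') r := by
          simp [X, smul_sub]
        rw [h2, norm_smul, Real.norm_of_nonneg (hwpos r).le]
        exact mul_le_mul (hwm hr) ((z - z').norm_coe_le_norm r) (norm_nonneg _) this.le
      calc ‖G z s - G z' s‖ ≤ l s * ‖segment Δ (X z) s - segment Δ (X z') s‖ := hs _ _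
        _ ≤ l s * (w s * ‖z - z'‖) := mul_le_mul_of_nonneg_left h1 (hl0 s)
        _ = _ := by ring
    · push_cast
      ring
  obtain ⟨z, hz⟩ : ∃ z, T z = z := ⟨_, hT.fixedPoint_isFixedPt⟩
  have hXz : ∀ t, X z t = x₀.val t + ∫ s in (0 : ℝ)..(max t 0), G z s := fun t => by
    have h1 : z t = (w t)⁻¹ • ∫ s in (0 : ℝ)..(max t 0), G z s := by
      conv_lhs => rw [← hz]
      rfl
    change x₀.val t + w t • z t = _
    rw [h1, smul_smul, mul_inv_cancel₀ (hwpos t).ne', one_smul]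
  refine ⟨X z, hX z, fun t ht => ?_, hGi z, fun t ht => ?_⟩
  · rw [hXz, max_eq_right ht]
    simp
  · rw [hXz, max_eq_left ht, val_zero_of_nonneg x₀ ht]

/-! ### Radial truncation -/

/-- The radial retraction of a normed space onto the closed ball of radius `R > 0`. -/
def radialTrunc {E : Type*} [NormedAddCommGroup E] [NormedSpace ℝ E] (R : ℝ) (v : E) : E :=
  (R / max R ‖v‖) • v

section radialTrunc

variable {E : Type*} [NormedAddCommGroup E] [NormedSpace ℝ E] {R : ℝ}

theorem radialTrunc_of_norm_le (hR : 0 < R) {v : E} (hv : ‖v‖ ≤ R) : radialTrunc R v = v := by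
  rw [radialTrunc, max_eq_left hv, div_self hR.ne', one_smul]

theorem norm_radialTrunc_le (hR : 0 < R) (v : E) : ‖radialTrunc R v‖ ≤ R := by
  have hm : 0 < max R ‖v‖ := lt_max_of_lt_left hR
  rw [radialTrunc, norm_smul, Real.norm_of_nonneg (by positivity), div_mul_eq_mul_div,
    div_le_iff₀ hm]
  exact mul_le_mul_of_nonneg_left (le_max_right _ _) hR.le

/-- Constant `2` holds in every normed space; the state space carries a sup norm, so projection
arguments from Hilbert spaces do not apply. The difference splits into a change of vector and a
change of scaling factor. -/
theorem norm_radialTrunc_sub_le (hR : 0 < R) (v v' : E) :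
    ‖radialTrunc R v - radialTrunc R v'‖ ≤ 2 * ‖v - v'‖ := by
  have hab : |max R ‖v'‖ - max R ‖v‖| ≤ ‖v - v'‖ := by
    rw [max_comm R, max_comm R, norm_sub_rev]
    exact (abs_max_sub_max_le_abs ‖v'‖ ‖v‖ R).trans (abs_norm_sub_norm_le v' v)
  set a := max R ‖v‖ with ha
  set b := max R ‖v'‖ with hb
  have ha0 : 0 < a := lt_max_of_lt_left hR
  have hb0 : 0 < b := lt_max_of_lt_left hR
  have hsplit : radialTrunc R v - radialTrunc R v' =
      (R / a) • (v - v') + (R / a * ((b - a) / b)) • v' := by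
    rw [radialTrunc, radialTrunc, ← ha, ← hb, smul_sub, sub_add, ← sub_smul]
    congr 2
    field_simp
    ring
  have h1 : R / a ≤ 1 := (div_le_one ha0).mpr (le_max_left _ _)
  have h2 : ‖v'‖ ≤ b := le_max_right _ _
  rw [hsplit]
  refine (norm_add_le _ _).trans ?_
  rw [norm_smul, norm_smul, norm_mul, norm_div (b - a), Real.norm_of_nonneg (by positivity),
    Real.norm_of_nonneg hb0.le, Real.norm_eq_abs, two_mul]
  refine add_le_add (mul_le_of_le_one_left (norm_nonneg _) h1) ?_
  calc R / a * (|b - a| / b) * ‖v'‖ ≤ 1 * (|b - a| / b) * b := by gcongr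
    _ = |b - a| := by field_simp
    _ ≤ ‖v - v'‖ := hab

theorem continuous_radialTrunc_comp {R : ℝ → ℝ} {g : ℝ → E} (hR : Continuous R)
    (hR0 : ∀ s, 0 < R s) (hg : Continuous g) : Continuous fun s => radialTrunc (R s) (g s) :=
  (hR.div (hR.max hg.norm) fun s => (lt_max_of_lt_left (hR0 s)).ne').smul hg

end radialTrunc

/-! ### Inputs -/

theorem IsInput.ae_nnnorm_le {m : ℕ} {u : ℝ → Vec m} (hu : IsInput u) (t : ℝ≥0) :
    ∀ᵐ s, s ∈ Icc 0 (t : ℝ) → ‖u s‖₊ ≤ inputNorm u t := by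
  rw [← ae_restrict_iff' measurableSet_Icc]
  filter_upwards [enorm_ae_le_eLpNormEssSup u (volume.restrict (Icc 0 (t : ℝ)))] with s hs
  rw [← eLpNorm_exponent_top] at hs
  exact (ENNReal.coe_le_coe.mp (by rwa [inputNorm, ENNReal.coe_toNNReal (hu t).2.ne]))

theorem IsInput.inputNorm_mono {m : ℕ} {u : ℝ → Vec m} (hu : IsInput u) :
    Monotone (inputNorm u) := fun _ t hst =>
  ENNReal.toNNReal_mono (hu t).2.ne <| eLpNorm_mono_measure _ <|
    Measure.restrict_mono (Icc_subset_Icc_right (NNReal.coe_le_coe.mpr hst)) le_rfl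

theorem IsInput.aestronglyMeasurable {m : ℕ} {u : ℝ → Vec m} (hu : IsInput u) :
    AEStronglyMeasurable ((Ici 0).indicator u) volume := by
  rw [aestronglyMeasurable_indicator_iff measurableSet_Ici]
  have h : Ici (0 : ℝ) = ⋃ k : ℕ, Icc 0 (k : ℝ) := by
    ext s
    simp only [mem_Ici, mem_iUnion, mem_Icc, exists_and_left, iff_self_and]
    exact fun _ => exists_nat_ge s
  rw [h, aestronglyMeasurable_iUnion_iff]
  exact fun k => (hu k).1

theorem IsInput.ae_nnnorm_le_shift {m : ℕ} {u : ℝ → Vec m} (hu : IsInput u) :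
    ∀ᵐ s, ‖(Ici 0).indicator u s‖₊ ≤ inputNorm u (s.toNNReal + 1) := by
  have h : ∀ᵐ s, ∀ k : ℕ, s ∈ Icc 0 ((k : ℝ≥0) : ℝ) → ‖u s‖₊ ≤ inputNorm u k :=
    ae_all_iff.mpr fun k => hu.ae_nnnorm_le k
  filter_upwards [h] with s hs
  by_cases h0 : s ∈ Ici 0
  · rw [indicator_of_mem h0]
    have h0 : 0 ≤ s := h0
    -- Countably many a.e. bounds, on `[0, k]`, suffice; rounding `s` up costs the `+ 1`.
    refine (hs ⌈s⌉₊ ⟨h0, by simpa using Nat.le_ceil s⟩).trans (hu.inputNorm_mono ?_)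
    rw [← NNReal.coe_le_coe]
    push_cast
    rw [Real.coe_toNNReal s h0]
    exact (Nat.ceil_lt_add_one h0).le
  · simp [indicator_of_notMem h0]

/-! ### Global solutions under an a priori bound -/

theorem LipschitzOnBounded.continuous {Δ : ℝ≥0} {n m : ℕ} {f : Hist Δ n → Vec m → Vec n}
    (hf : LipschitzOnBounded f) : Continuous fun p : Hist Δ n × Vec m => f p.1 p.2 := by
  refine continuous_iff_continuousAt.mpr fun p => ?_
  obtain ⟨L, hL, h⟩ := hf (‖p‖ + 1) (by positivity)
  have hlim : Tendsto (fun q : Hist Δ n × Vec m => L * (‖q.1 - p.1‖ + ‖q.2 - p.2‖)) (𝓝 p)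
      (𝓝 0) := by
    have hc : Continuous fun q : Hist Δ n × Vec m => L * (‖q.1 - p.1‖ + ‖q.2 - p.2‖) := by
      fun_prop
    simpa using hc.tendsto p
  refine tendsto_iff_norm_sub_tendsto_zero.mpr
    (squeeze_zero' (Eventually.of_forall fun _ => norm_nonneg _) ?_ hlim)
  filter_upwards [continuous_norm.continuousAt.eventually_lt_const (lt_add_one ‖p‖)] with q hq
  exact h _ _ _ _ ((norm_fst_le q).trans hq.le) ((norm_fst_le p).trans (lt_add_one _).le)
    ((norm_snd_le q).trans hq.le) ((norm_snd_le p).trans (lt_add_one _).le)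

/-- Truncation at a radius above the a priori bound `B`, followed by a first-exit argument. -/
theorem exists_isSolution_of_bound {Δ : ℝ≥0} {n m : ℕ} {f : Hist Δ n → Vec m → Vec n}
    (hf : LipschitzOnBounded f) (x₀ : Hist Δ n) {u : ℝ → Vec m} (hu : IsInput u)
    {B : ℝ → ℝ} (hB : Monotone B) (hB0 : ∀ t, ‖x₀‖ ≤ B t)
    (hbound : ∀ x : ℝ → Vec n, Continuous x → (∀ τ : Icc (-(Δ : ℝ)) 0, x τ = x₀ τ) →
      ∀ t, 0 ≤ t → IntervalIntegrable (fun τ => f (segment Δ x τ) (u τ)) volume 0 t →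
      (∀ s ∈ Icc 0 t, x s = x 0 + ∫ τ in (0 : ℝ)..s, f (segment Δ x τ) (u τ)) → ‖x t‖ ≤ B t) :
    ∃ x : ℝ → Vec n, IsSolution f x₀ u ⊤ x := by
  -- `B` may jump, so a continuous radius is selected above `B + 1`, using local boundedness of `B`
  -- and convexity of half-lines.
  obtain ⟨R, hR⟩ : ∃ R : C(ℝ, ℝ), ∀ s, R s ∈ Ici (B s + 1) := by
    refine exists_continuous_forall_mem_convex_of_local_const (fun s => convex_Ici _)
      fun s => ⟨B (s + 1) + 1, ?_⟩
    filter_upwards [Iio_mem_nhds (lt_add_one s)] with y hy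
    exact add_le_add_left (hB (le_of_lt hy)) 1
  have hRpos : ∀ s, 0 < R s := fun s => by
    have := hR s
    rw [mem_Ici] at this
    linarith [norm_nonneg x₀, hB0 s]
  set v : ℝ → Vec m := (Ici 0).indicator u with hv
  set N : ℝ → ℝ≥0 := fun s => inputNorm u (s.toNNReal + 1) with hN
  have hNm : Monotone N := fun s t hst =>
    hu.inputNorm_mono (add_le_add_left (Real.toNNReal_mono hst) 1)
  let F : ℝ → Hist Δ n → Vec n := fun s φ => f (radialTrunc (R s) φ) (v s)
  -- Guarding by `‖v s‖₊ ≤ N s` confines the requirement to times where the input obeys its a.e.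
  -- bound; on the null remainder only `0 ≤ r` is asked.
  obtain ⟨l, hl⟩ : ∃ l : C(ℝ, ℝ), ∀ s, l s ∈ {r : ℝ | 0 ≤ r ∧ (‖v s‖₊ ≤ N s →
      (∀ φ ψ, ‖F s φ - F s ψ‖ ≤ r * ‖φ - ψ‖) ∧ ‖F s 0‖ ≤ r)} := by
    refine exists_continuous_forall_mem_convex_of_local_const (fun s => ?_) fun s => ?_
    · refine OrdConnected.convex ⟨fun a ha b _ r hr => ⟨ha.1.trans hr.1, fun hs => ?_⟩⟩
      obtain ⟨h1, h2⟩ := ha.2 hs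
      exact ⟨fun φ ψ => (h1 φ ψ).trans (mul_le_mul_of_nonneg_right hr.1 (norm_nonneg _)),
        h2.trans hr.1⟩
    · have hr : 0 < max (R s + 1) (N (s + 1)) :=
        lt_max_of_lt_left (by linarith [hRpos s])
      set r : ℝ := max (R s + 1) (N (s + 1)) with hrdef
      obtain ⟨L, hL, h⟩ := hf r hr
      -- `2 * L` is the Lipschitz constant after truncation; the rest bounds `F y 0`.
      refine ⟨2 * L + L * r + ‖f 0 0‖, ?_⟩
      filter_upwards [Iio_mem_nhds (lt_add_one s),
        R.continuous.continuousAt.eventually_lt_const (lt_add_one (R s))] with y hy hRy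
      refine ⟨by positivity, fun hvy => ?_⟩
      have hvr : ‖v y‖ ≤ r := by
        have h1 : ‖v y‖₊ ≤ N (s + 1) := hvy.trans (hNm (le_of_lt hy))
        exact (NNReal.coe_le_coe.mpr h1).trans (le_max_right _ _)
      have htr : ∀ φ : Hist Δ n, ‖radialTrunc (R y) φ‖ ≤ r := fun φ =>
        (norm_radialTrunc_le (hRpos y) φ).trans (hRy.le.trans (le_max_left _ _))
      constructor
      · intro φ ψ
        have h1 := h _ _ _ _ (htr φ) (htr ψ) hvr hvr
        rw [sub_self, norm_zero, add_zero] at h1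
        calc ‖F y φ - F y ψ‖ ≤ L * (2 * ‖φ - ψ‖) := h1.trans
              (mul_le_mul_of_nonneg_left (norm_radialTrunc_sub_le (hRpos y) φ ψ) hL.le)
          _ = (2 * L) * ‖φ - ψ‖ := by ring
          _ ≤ _ := by
            refine mul_le_mul_of_nonneg_right ?_ (norm_nonneg _)
            rw [add_assoc]
            exact le_add_of_nonneg_right (by positivity)
      · have h1 := h 0 0 (v y) 0 (by simpa using hr.le) (by simpa using hr.le) hvr
          (by simpa using hr.le)
        rw [sub_self, norm_zero, zero_add, sub_zero] at h1
        have h2 : F y 0 = f 0 (v y) := by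
          simp only [F, radialTrunc, smul_zero]
        rw [h2]
        have h3 := norm_le_insert' (f 0 (v y)) (f 0 0)
        have h4 : L * ‖v y‖ ≤ L * r := mul_le_mul_of_nonneg_left hvr hL.le
        linarith
  obtain ⟨x, hxc, hx0, hxi, hx⟩ := exists_global_solution_of_lipschitz x₀ (F := F) l.continuous
    (fun s => (hl s).1) (hu.ae_nnnorm_le_shift.mono fun s hs => ((hl s).2 hs).1)
    (hu.ae_nnnorm_le_shift.mono fun s hs => ((hl s).2 hs).2)
    (fun x hx => hf.continuous.comp_aestronglyMeasurable
      ((continuous_radialTrunc_comp R.continuous hRpos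
        (continuous_segment hx)).aestronglyMeasurable.prodMk hu.aestronglyMeasurable))
  have hinit : ∀ τ : Icc (-(Δ : ℝ)) 0, x τ = x₀ τ := fun τ => by
    rw [hx0 _ τ.2.2, Hist.val_of_mem _ τ.2]
  have hinit0 : x 0 = x₀.val 0 := hx0 0 le_rfl
  -- While segments stay in the ball, the truncated and original equations coincide. The endpoint
  -- `t` is excluded, being null, so that this applies at the first exit time.
  have hF : ∀ t, 0 ≤ t → (∀ s ∈ Ico 0 t, ‖segment Δ x s‖ ≤ R s) →
      IntervalIntegrable (fun τ => f (segment Δ x τ) (u τ)) volume 0 t ∧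
      x t = x₀.val 0 + ∫ τ in (0 : ℝ)..t, f (segment Δ x τ) (u τ) := by
    intro t ht h
    have hae : ∀ᵐ s, s ∈ uIoc 0 t → F s (segment Δ x s) = f (segment Δ x s) (u s) := by
      filter_upwards [Measure.ae_ne volume t] with s hst hs
      rw [uIoc_of_le ht] at hs
      simp only [F, hv]
      rw [radialTrunc_of_norm_le (hRpos s) (h s ⟨hs.1.le, lt_of_le_of_ne hs.2 hst⟩),
        indicator_of_mem (mem_Ici.mpr hs.1.le)]
    refine ⟨(hxi 0 t).congr_ae ((ae_restrict_iff' measurableSet_uIoc).mpr hae), ?_⟩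
    rw [hx t ht, intervalIntegral.integral_congr_ae hae]
  have hxB : ∀ t, 0 ≤ t → (∀ s ∈ Ico 0 t, ‖segment Δ x s‖ ≤ R s) → ‖x t‖ ≤ B t := fun t ht h =>
    hbound x hxc hinit t ht (hF t ht h).1 fun s hs => by
      rw [hinit0]
      exact (hF s hs.1 fun r hr => h r ⟨hr.1, hr.2.trans_le hs.2⟩).2
  have hlt : ∀ s, 0 ≤ s → ‖segment Δ x s‖ < R s := by
    by_contra! hcon
    set S : Set ℝ := Ici 0 ∩ {s | R s ≤ ‖segment Δ x s‖} with hS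
    have hSc : IsClosed S :=
      isClosed_Ici.inter (isClosed_le R.continuous (continuous_segment hxc).norm)
    have hSb : BddBelow S := ⟨0, fun s hs => hs.1⟩
    obtain ⟨h0, h1⟩ := hSc.csInf_mem hcon hSb
    set r := sInf S with hr
    have h0 : 0 ≤ r := h0
    have h1 : R r ≤ ‖segment Δ x r‖ := h1
    have hbefore : ∀ s ∈ Ico 0 r, ‖segment Δ x s‖ ≤ R s := fun s hs => by
      by_contra! hlt
      exact notMem_of_lt_csInf hs.2 hSb ⟨hs.1, hlt.le⟩
    -- At the first exit time `r` the a priori bound still holds, contradicting `R r ≥ B r + 1`.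
    have h2 : ‖segment Δ x r‖ ≤ B r := by
      refine norm_segment_le hxc ((norm_nonneg _).trans (hB0 r)) fun s hs _ => ?_
      rcases le_total s 0 with hs0 | hs0
      · rw [hx0 s hs0]
        exact (norm_val_le _ _).trans (hB0 r)
      · exact (hxB s hs0 fun q hq => hbefore q ⟨hq.1, hq.2.trans_le hs⟩).trans (hB hs)
    have h3 : B r + 1 ≤ R r := hR r
    linarith
  exact ⟨x, EReal.coe_lt_top 0, hxc.continuousOn, hinit,
    fun t ht _ => (hF t ht fun s hs => (hlt s hs.1).le).1,
    fun t ht _ => (hF t ht fun s hs => (hlt s hs.1).le).2⟩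

/-! ### Comparison functions -/

/-- The exponential `𝒦ℒ` function `(s, t) ↦ κ exp (-(r t)) s`. -/
def expKL (κ : ℝ≥0) (r : ℝ) (s t : ℝ≥0) : ℝ≥0 := κ * (Real.exp (-(r * t))).toNNReal * s

theorem coe_expKL (κ : ℝ≥0) (r : ℝ) (s t : ℝ≥0) :
    (expKL κ r s t : ℝ) = κ * Real.exp (-(r * t)) * s := by
  simp [expKL, (Real.exp_pos _).le]

theorem classKL_expKL {κ : ℝ≥0} {r : ℝ} (hκ : 0 < κ) (hr : 0 < r) : ClassKL (expKL κ r) where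
  classK t := by
    have h : 0 < κ * (Real.exp (-(r * t))).toNNReal :=
      mul_pos hκ (Real.toNNReal_pos.mpr (Real.exp_pos _))
    refine ⟨continuous_const.mul continuous_id, fun s s' hs => ?_, by simp [expKL]⟩
    exact mul_lt_mul_of_pos_left hs h
  classL s := by
    refine ⟨?_, fun t t' ht => ?_, ?_⟩
    · unfold expKL
      fun_prop
    · have : (t : ℝ) ≤ t' := NNReal.coe_le_coe.mpr ht
      unfold expKL
      gcongr
    · have h1 : Tendsto (fun t : ℝ≥0 => r * (t : ℝ)) atTop atTop :=
        (NNReal.tendsto_coe_atTop.mpr tendsto_id).const_mul_atTop hr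
      have h2 := (Real.tendsto_exp_neg_atTop_nhds_zero.comp h1)
      have h3 : Tendsto (fun t : ℝ≥0 => (expKL κ r s t : ℝ)) atTop (𝓝 ((0 : ℝ≥0) : ℝ)) := by
        simp only [coe_expKL]
        simpa using (h2.const_mul (κ : ℝ)).mul_const (s : ℝ)
      exact NNReal.tendsto_coe.mp h3

theorem ClassN.sqrt_mul {γ : ℝ≥0 → ℝ≥0} (hγ : ClassN γ) (d : ℝ≥0) :
    ClassN fun s => NNReal.sqrt (d * γ s) where
  continuous := NNReal.continuous_sqrt.comp (continuous_const.mul hγ.continuous)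
  monotone s t hst := NNReal.sqrt_le_sqrt.mpr (mul_le_mul_right (hγ.monotone hst) d)
  map_zero := by simp [hγ.map_zero]

/-! ### Restriction of solutions to compact intervals -/

theorem segment_congr {Δ : ℝ≥0} {n : ℕ} {x y : ℝ → Vec n} {t : ℝ}
    (h : ∀ s ∈ Icc (t - Δ) t, x s = y s) : segment Δ x t = segment Δ y t := by
  have : (fun τ : Icc (-(Δ : ℝ)) 0 => x (t + τ)) = fun τ : Icc (-(Δ : ℝ)) 0 => y (t + τ) :=
    funext fun τ => h _ ⟨by linarith [τ.2.1], by linarith [τ.2.2]⟩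
  by_cases hc : Continuous fun τ : Icc (-(Δ : ℝ)) 0 => x (t + τ)
  · rw [segment, segment, dif_pos hc, dif_pos (this ▸ hc)]
    ext1 τ
    exact congrFun this τ
  · rw [segment, segment, dif_neg hc, dif_neg (this ▸ hc)]

/-- The estimates need continuity on all of `ℝ`, while a solution is unconstrained outside `[-Δ,
T)`; freezing it outside `[-Δ, t]` changes nothing relevant up to time `t`. -/
theorem IsSolution.exists_continuous {Δ : ℝ≥0} {n m : ℕ} {f : Hist Δ n → Vec m → Vec n}
    {x₀ : Hist Δ n} {u : ℝ → Vec m} {T : EReal} {x : ℝ → Vec n} (hx : IsSolution f x₀ u T x)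
    {t : ℝ} (ht : 0 ≤ t) (htT : (t : EReal) < T) :
    ∃ y : ℝ → Vec n, Continuous y ∧ y t = x t ∧ (∀ τ : Icc (-(Δ : ℝ)) 0, y τ = x₀ τ) ∧
      IntervalIntegrable (fun τ => f (segment Δ y τ) (u τ)) volume 0 t ∧
      ∀ s ∈ Icc 0 t, y s = y 0 + ∫ τ in (0 : ℝ)..s, f (segment Δ y τ) (u τ) := by
  have hΔ := Δ.coe_nonneg
  have hle : -(Δ : ℝ) ≤ t := (neg_delay_nonpos Δ).trans ht
  have hT : ∀ s ≤ t, (s : EReal) < T := fun s hs => (EReal.coe_le_coe_iff.mpr hs).trans_lt htT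
  have hxc : ContinuousOn x (Icc (-(Δ : ℝ)) t) :=
    hx.continuousOn.mono fun s hs => ⟨hs.1, hT s hs.2⟩
  set y : ℝ → Vec n := IccExtend hle ((Icc (-(Δ : ℝ)) t).domRestrict x) with hy
  have hyx : ∀ s ∈ Icc (-(Δ : ℝ)) t, y s = x s := fun s hs => IccExtend_of_mem _ _ hs
  have hseg : ∀ s ∈ Icc 0 t, segment Δ y s = segment Δ x s := fun s hs =>
    segment_congr fun r hr => hyx r ⟨by linarith [hr.1, hs.1], hr.2.trans hs.2⟩
  have hg : ∀ s ∈ Icc 0 t, f (segment Δ x s) (u s) = f (segment Δ y s) (u s) := fun s hs => by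
    rw [hseg s hs]
  refine ⟨y, hxc.domRestrict.Icc_extend', hyx t ⟨hle, le_rfl⟩, fun τ => ?_, ?_, fun s hs => ?_⟩
  · rw [hyx τ ⟨τ.2.1, τ.2.2.trans ht⟩, hx.initial]
  · refine (hx.integrable t ht htT).congr fun s hs => hg s ?_
    rw [uIoc_of_le ht] at hs
    exact Ioc_subset_Icc_self hs
  · have h0 : y 0 = x₀.val 0 := by
      rw [hyx 0 ⟨neg_delay_nonpos Δ, ht⟩, Hist.val_of_mem _ ⟨neg_delay_nonpos Δ, le_rfl⟩]
      exact hx.initial ⟨0, neg_delay_nonpos Δ, le_rfl⟩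
    rw [hyx s ⟨by linarith [hs.1], hs.2⟩, h0, hx.integral_eq s hs.1 (hT s hs.2)]
    congr 1
    refine intervalIntegral.integral_congr fun r hr => hg r ?_
    rw [uIcc_of_le hs.1] at hr
    exact ⟨hr.1, hr.2.trans hs.2⟩

/-! ### Input-to-state stability -/

/-- The input-to-state estimate along continuous functions that satisfy the integral equation,
with an exponential transient. -/
theorem exists_exponential_estimate {Δ : ℝ≥0} {n m : ℕ} {f : Hist Δ n → Vec m → Vec n}
    {P₁ P₂ Q : Matrix (Fin n) (Fin n) ℝ} (hP₁ : P₁.PosDef) (hP₂ : P₂.PosDef) (hQ : Q.PosDef)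
    {γ : ℝ≥0 → ℝ≥0} (hγ : Monotone γ)
    (hV : ∀ (φ : Hist Δ n) (v : Vec m),
      driverDeriv (quadLKF Δ P₁ P₂) φ (f φ v) ≤
        ((-quad Q (φ.val 0) + (γ ‖v‖₊ : ℝ) : ℝ) : EReal)) :
    ∃ (κ d : ℝ≥0) (r : ℝ), 0 < κ ∧ 0 < r ∧
      ∀ (x₀ : Hist Δ n) (u : ℝ → Vec m), IsInput u → ∀ x : ℝ → Vec n, Continuous x →
        (∀ τ : Icc (-(Δ : ℝ)) 0, x τ = x₀ τ) → ∀ t : ℝ≥0,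
        IntervalIntegrable (fun τ => f (segment Δ x τ) (u τ)) volume 0 t →
        (∀ s ∈ Icc 0 (t : ℝ), x s = x 0 + ∫ τ in (0 : ℝ)..s, f (segment Δ x τ) (u τ)) →
        ‖x t‖₊ ≤ expKL κ r ‖x₀‖₊ t + NNReal.sqrt (d * γ (inputNorm u t)) := by
  obtain ⟨C₁, hC₁0, hC₁⟩ := exists_quad_le P₁
  obtain ⟨C₂, hC₂0, hC₂⟩ := exists_quad_le P₂
  obtain ⟨a, ha, haP⟩ := exists_le_quad hP₁
  obtain ⟨c, hc, hrate⟩ := exists_decay_rate (Δ : ℝ) P₁ P₂ Δ.coe_nonneg hQ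
  set K : ℝ := C₁ + Real.exp (c * Δ) * Δ * C₂ with hK
  have hK0 : 0 < K := by positivity
  -- Read off from `a‖x(t)‖² ≤ K e^{-ct} ‖x₀‖² + γ / c`; the square root halves the rate.
  refine ⟨(√(K / a)).toNNReal, (1 / (c * a)).toNNReal, c / 2,
    Real.toNNReal_pos.mpr (by positivity), by positivity, ?_⟩
  intro x₀ u hu x hx hx₀ t hint heq
  have hinit : ∀ s ∈ Icc (-(Δ : ℝ)) 0, ‖x s‖ ≤ ‖x₀‖ := fun s hs => by
    rw [hx₀ ⟨s, hs⟩]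
    exact x₀.norm_coe_le_norm _
  have hV' : ∀ (φ : Hist Δ n) (v : Vec m),
      fderiv ℝ (quad P₁) (φ.val 0) (f φ v) + quad P₂ (φ.val 0) - quad P₂ (φ.val (-Δ)) ≤
        -quad Q (φ.val 0) + γ ‖v‖₊ := fun φ v => by
    have := hV φ v
    rwa [driverDeriv_quadLKF, EReal.coe_le_coe_iff] at this
  have hest := quad_mul_exp_le hP₂ hγ hV' hc hrate hC₁ hC₁0 hC₂0 hC₂ hx t.coe_nonneg hint heq
    hinit (hu.ae_nnnorm_le t)
  have hsq : ‖x t‖ ^ 2 ≤ K / a * Real.exp (-(c * t)) * ‖x₀‖ ^ 2 +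
      1 / (c * a) * γ (inputNorm u t) := by
    have h1 := (mul_le_mul_of_nonneg_right (haP (x t)) (Real.exp_pos (c * t)).le).trans hest
    have h2 : a * ‖x t‖ ^ 2 ≤ K * ‖x₀‖ ^ 2 * Real.exp (-(c * t)) + γ (inputNorm u t) / c := by
      have h3 := mul_le_mul_of_nonneg_right h1 (Real.exp_pos (-(c * t))).le
      have he : Real.exp (c * t) * Real.exp (-(c * t)) = 1 := by
        rw [← Real.exp_add, add_neg_cancel, Real.exp_zero]
      rw [add_mul, mul_assoc, mul_assoc (_ / c), he, mul_one, mul_one] at h3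
      exact h3
    calc ‖x t‖ ^ 2 = a * ‖x t‖ ^ 2 / a := by field_simp
      _ ≤ (K * ‖x₀‖ ^ 2 * Real.exp (-(c * t)) + γ (inputNorm u t) / c) / a := by gcongr
      _ = _ := by
        field_simp
  rw [← NNReal.coe_le_coe, NNReal.coe_add, coe_expKL, coe_nnnorm, coe_nnnorm, Real.coe_sqrt,
    NNReal.coe_mul, Real.coe_toNNReal _ (by positivity), Real.coe_toNNReal _ (by positivity)]
  -- Subadditivity of the square root: after squaring, the cross term is nonnegative.
  refine le_of_sq_le_sq ?_ (by positivity)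
  have hA : (√(K / a) * Real.exp (-(c / 2 * t)) * ‖x₀‖) ^ 2 =
      K / a * Real.exp (-(c * t)) * ‖x₀‖ ^ 2 := by
    rw [mul_pow, mul_pow, Real.sq_sqrt (by positivity), ← Real.exp_nat_mul]
    congr 3
    push_cast
    ring
  have hB : √(1 / (c * a) * γ (inputNorm u t)) ^ 2 = 1 / (c * a) * γ (inputNorm u t) :=
    Real.sq_sqrt (by positivity)
  rw [add_sq, hA, hB]
  have : 0 ≤ 2 * (√(K / a) * Real.exp (-(c / 2 * t)) * ‖x₀‖) *
    √(1 / (c * a) * γ (inputNorm u t)) := by positivity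
  linarith

end DelaySystem

end

theorem mainTheorem3 (Δ : ℝ≥0) (n m : ℕ)
    (f : DelaySystem.Hist Δ n → DelaySystem.Vec m → DelaySystem.Vec n)
    (hf : DelaySystem.LipschitzOnBounded f) (hf0 : f 0 0 = 0)
    (P₁ P₂ Q : Matrix (Fin n) (Fin n) ℝ)
    (hP₁ : P₁.PosDef) (hP₂ : P₂.PosDef) (hQ : Q.PosDef)
    (γ : ℝ≥0 → ℝ≥0) (hγ : DelaySystem.ClassN γ)
    (hV : ∀ (φ : DelaySystem.Hist Δ n) (v : DelaySystem.Vec m),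
      DelaySystem.driverDeriv (DelaySystem.quadLKF Δ P₁ P₂) φ (f φ v) ≤
        ((-DelaySystem.quad Q (φ.val 0) + (γ ‖v‖₊ : ℝ) : ℝ) : EReal)) :
    DelaySystem.InputToStateStable f := by
  obtain ⟨κ, d, r, hκ, hr, hest⟩ :=
    DelaySystem.exists_exponential_estimate hP₁ hP₂ hQ hγ.monotone hV
  have hβ := DelaySystem.classKL_expKL hκ hr
  have hμ := hγ.sqrt_mul d
  refine ⟨DelaySystem.expKL κ r, _, hβ, hμ, fun x₀ u hu => ⟨?_, ?_⟩⟩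
  · refine DelaySystem.exists_isSolution_of_bound hf x₀ hu
      -- The transient is frozen at time `0` so that `B` is monotone, and `‖x₀‖₊` is added so that
      -- `B` dominates the initial segment.
      (B := fun t => (‖x₀‖₊ + (DelaySystem.expKL κ r ‖x₀‖₊ 0 +
        NNReal.sqrt (d * γ (DelaySystem.inputNorm u t.toNNReal))) : ℝ≥0)) ?_ ?_ ?_
    · intro s t hst
      have := hμ.monotone (hu.inputNorm_mono (Real.toNNReal_mono hst))
      exact NNReal.coe_le_coe.mpr (add_le_add_right (add_le_add_right this _) _)
    · intro t
      exact NNReal.coe_le_coe.mpr (le_add_of_nonneg_right zero_le : ‖x₀‖₊ ≤ _)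
    · intro x hx hx₀ t ht hint heq
      lift t to ℝ≥0 using ht
      have h := hest x₀ u hu x hx hx₀ t hint heq
      simp only [Real.toNNReal_coe]
      refine NNReal.coe_le_coe.mpr (h.trans ?_ : ‖x t‖₊ ≤ _)
      exact (add_le_add_left ((hβ.classL _).antitone zero_le) _).trans
        (le_add_of_nonneg_left zero_le)
  · intro T x hx t ht
    obtain ⟨y, hy, hyt, hy₀, hint, heq⟩ := hx.exists_continuous t.coe_nonneg ht
    rw [← hyt]
    exact hest x₀ u hu y hy hy₀ t hint heq
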